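/- **Theorem.** A (real) elastic $1$-tensor field on $\mathbb{R}^2$ is a symmetric $2$-tensor field $v=(v_{ij})$; an elastic $2$-tensor field is a $4$-tensor field $w=(w_{ijkl})$ with $w_{ijkl}=w_{jikl}=w_{ijlk}=w_{klij}$. For smooth elastic $1$-tensor fields $v$, vector fields $u$ and elastic $2$-tensor fields $w$ put $$(Hv)_{ijkl}=\tfrac12\bigl(\partial_i\partial_j v_{kl}+\partial_k\partial_l v_{ij}\bigr),\qquad (Ku)_{ijkl}=\tfrac14(\partial_i u_j+\partial_j u_i)\,\delta_{kl}+\tfrac14(\partial_k u_l+\partial_l u_k)\,\delta_{ij},$$ with formal $L^2$-adjoints $$(H^*w)_{ij}=\sum_{k,l}\partial_k\partial_l w_{ijkl},\qquad (K^*w)_i=-\sum_{j,k}\partial_j w_{ijkk}.$$ Let $f$ be an elastic $2$-tensor field on $\mathbb{R}^2$ whose components are Schwartz functions and satisfy $\int_{\mathbb{R}^2} f_{ijkl}(x)\,dx=0$ for all $i,j,k,l$. Then there exist a smooth elastic $1$-tensor field $v$, a smooth vector field $u$ and a smooth elastic $2$-tensor field $g$, all tending to $0$ as $|x|\to\infty$,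 such that $$f=Hv+Ku+g,\qquad K^*g=0,\quad H^*g=0,\qquad \operatorname{div}u=0 \qquad\text{on }\mathbb{R}^2 .$$ The decomposition is unique in the following sense. Let $v',u',g'$ be a smooth elastic $1$-tensor field, a smooth vector field and a smooth elastic $2$-tensor field with $f=Hv'+Ku'+g'$ and $K^*g'=H^*g'=0$, and suppose that $v'$ and $u'$ tend to $0$ as $|x|\to\infty$. Then $g'=g$. If moreover $\operatorname{div}u'=0$, then also $v'=v$ and $u'=u$. -/

import Mathlib

open Filter Topology MeasureTheory
open scoped ContDiff SchwartzMap

namespace Elastic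

/-- Euclidean space `ℝⁿ`. -/
abbrev Pt (n : ℕ) := EuclideanSpace ℝ (Fin n)

/-- Vector fields on `ℝⁿ`, given by their Cartesian components. -/
abbrev VectorField (n : ℕ) := Fin n → Pt n → ℝ

/-- `2`-tensor fields on `ℝⁿ`, given by their Cartesian components. -/
abbrev TensorField2 (n : ℕ) := Fin n → Fin n → Pt n → ℝ

/-- `4`-tensor fields on `ℝⁿ`, given by their Cartesian components. -/
abbrev TensorField4 (n : ℕ) := Fin n → Fin n → Fin n → Fin n → Pt n → ℝ

variable {n : ℕ}

/-- An elastic `1`-tensor field is a symmetric `2`-tensor field. -/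
def IsElastic1 (v : TensorField2 n) : Prop :=
  ∀ i j, v i j = v j i

/-- An elastic `2`-tensor field is a `4`-tensor field that is symmetric in the first two indices,
symmetric in the last two indices, and invariant under the exchange of these two pairs. -/
def IsElastic2 (w : TensorField4 n) : Prop :=
  ∀ i j k l, w i j k l = w j i k l ∧ w i j k l = w i j l k ∧ w i j k l = w k l i j

/-- The partial derivative `∂φ/∂xᵢ`. -/
noncomputable def pd (i : Fin n) (φ : Pt n → ℝ) : Pt n → ℝ :=
  fun x => fderiv ℝ φ x (EuclideanSpace.single i 1)

/-- The Kronecker delta. -/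
def kron (i j : Fin n) : ℝ := if i = j then 1 else 0

/-- `(Hv)_{ijkl} = ½ (∂ᵢ∂ⱼ v_{kl} + ∂ₖ∂ₗ v_{ij})`. -/
noncomputable def opH (v : TensorField2 n) : TensorField4 n :=
  fun i j k l x => (1 / 2) * (pd i (pd j (v k l)) x + pd k (pd l (v i j)) x)

/-- The formal `L²`-adjoint of `H`: `(H*w)_{ij} = ∑_{k,l} ∂ₖ∂ₗ w_{ijkl}`. -/
noncomputable def opHStar (w : TensorField4 n) : TensorField2 n :=
  fun i j x => ∑ k, ∑ l, pd k (pd l (w i j k l)) x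

/-- `(Ku)_{ijkl} = ¼ (∂ᵢuⱼ + ∂ⱼuᵢ) δ_{kl} + ¼ (∂ₖuₗ + ∂ₗuₖ) δ_{ij}`. -/
noncomputable def opK (u : VectorField n) : TensorField4 n :=
  fun i j k l x =>
    (1 / 4) * (pd i (u j) x + pd j (u i) x) * kron k l
      + (1 / 4) * (pd k (u l) x + pd l (u k) x) * kron i j

/-- The formal `L²`-adjoint of `K`: `(K*w)ᵢ = -∑_{k,j} ∂ⱼ w_{ijkk}`. -/
noncomputable def opKStar (w : TensorField4 n) : VectorField n :=
  fun i x => -∑ k, ∑ j, pd j (w i j k k) x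

/-- The divergence of a vector field. -/
noncomputable def divergence (u : VectorField n) : Pt n → ℝ :=
  fun x => ∑ i, pd i (u i) x

/-- `φ(x) → 0` as `|x| → ∞`. -/
def VanishesAtInfinity (φ : Pt n → ℝ) : Prop :=
  Tendsto φ (cocompact (Pt n)) (𝓝 0)

/-- `f = Hv + Ku + g` with `K*g = 0`, `H*g = 0`, where `v` is a smooth elastic `1`-tensor field,
`u` a smooth vector field and `g` a smooth elastic `2`-tensor field. -/
structure IsDecomposition (f : TensorField4 n)
    (v : TensorField2 n) (u : VectorField n) (g : TensorField4 n) : Prop where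
  smooth_v : ∀ i j, ContDiff ℝ ∞ (v i j)
  smooth_u : ∀ i, ContDiff ℝ ∞ (u i)
  smooth_g : ∀ i j k l, ContDiff ℝ ∞ (g i j k l)
  elastic_v : IsElastic1 v
  elastic_g : IsElastic2 g
  eq_add : ∀ i j k l x, f i j k l x = opH v i j k l x + opK u i j k l x + g i j k l x
  kStar_g : ∀ i x, opKStar g i x = 0
  hStar_g : ∀ i j x, opHStar g i j x = 0

end Elastic

/-! Applying `H*` and `K*` to `f = Hv + Ku + g` removes `g` and leaves constant-coefficient
equations for `v` and `u`. Write `ξ` for the gradient, `ξ⊥` for its rotation by a right angle and `Δ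
= ξ·ξ`.

Existence. With `div u = 0` one has `u = ξ⊥c`, and on the Fourier side the equations can be solved
explicitly for `c` and `v`; `g` is the remainder. Up to bounded multipliers, `v` is `Δ⁻¹f` and `u`
is a first derivative of `Δ⁻¹f`. Since `f` has mean zero, its symbol vanishes at the origin, so
division by `|y|²` leaves a singularity `|y|⁻¹`, which is integrable in the plane
(`rapidlyIntegrable_div_norm_sq`). Symbols integrable against all polynomial weights give smooth
fields, which decay by Riemann–Lebesgue.

Uniqueness. The difference of two decompositions decomposes `0`. Derivatives of functions vanishing
at infinity need not vanish there, so the argument runs in `WeaklyVanishing`, which is stable under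
derivatives and on which `Δ` is injective. Over the commutative ring generated by the partial
derivatives, elimination (`KernelEquations.potential_eqs`) gives `curl u = 0` and `Δv_{ij} = -δ_{ij}
div u`. Hence `Δg = 0` and `g = 0`; the only freedom left is `div u`. -/

namespace Elastic

/-! ### Partial derivatives and a Liouville theorem from the maximum principle -/

section Calculus

variable {n : ℕ}

lemma pd_add (i : Fin n) {φ ψ : Pt n → ℝ} (hφ : ContDiff ℝ ∞ φ) (hψ : ContDiff ℝ ∞ ψ) :
    pd i (φ + ψ) = pd i φ + pd i ψ := by
  ext x
  simp only [pd, Pi.add_apply]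
  rw [fderiv_add (hφ.differentiable (by simp) x) (hψ.differentiable (by simp) x)]
  rfl

lemma pd_const_smul (i : Fin n) (c : ℝ) {φ : Pt n → ℝ} (hφ : ContDiff ℝ ∞ φ) :
    pd i (c • φ) = c • pd i φ := by
  ext x
  simp only [pd, Pi.smul_apply]
  rw [fderiv_const_smul (hφ.differentiable (by simp) x)]
  rfl

lemma contDiff_pd (i : Fin n) {φ : Pt n → ℝ} (hφ : ContDiff ℝ ∞ φ) : ContDiff ℝ ∞ (pd i φ) :=
  (hφ.fderiv_right (m := ∞) (by simp)).clm_apply contDiff_const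

lemma pd_comm (i j : Fin n) {φ : Pt n → ℝ} (hφ : ContDiff ℝ ∞ φ) :
    pd i (pd j φ) = pd j (pd i φ) := by
  have key : ∀ i j : Fin n, ∀ x, pd i (pd j φ) x =
      fderiv ℝ (fderiv ℝ φ) x (EuclideanSpace.single i 1) (EuclideanSpace.single j 1) := by
    intro i j x
    have hd : DifferentiableAt ℝ (fderiv ℝ φ) x :=
      (hφ.fderiv_right (m := ∞) (by simp)).differentiable (by simp) x
    change fderiv ℝ (fun y => fderiv ℝ φ y (EuclideanSpace.single j 1)) x _ = _
    rw [fderiv_clm_apply hd (differentiableAt_const _)]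
    simp
  ext x
  rw [key, key]
  exact (hφ.contDiffAt.isSymmSndFDerivAt (by simp only [minSmoothness_of_isRCLikeNormedField]; exact WithTop.coe_le_coe.2 (OrderTop.le_top (2 : ℕ∞)))).eq _ _

lemma hasCompactSupport_pd (i : Fin n) {φ : Pt n → ℝ} (hφ : HasCompactSupport φ) :
    HasCompactSupport (pd i φ) :=
  hφ.fderiv_apply ℝ _

/-- The derivative of a function along a coordinate line. -/
lemma hasDerivAt_line (i : Fin n) {φ : Pt n → ℝ} (hφ : ContDiff ℝ ∞ φ) (z : Pt n) (t : ℝ) :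
    HasDerivAt (fun s : ℝ => φ (z + s • EuclideanSpace.single i 1))
      (pd i φ (z + t • EuclideanSpace.single i 1)) t := by
  have h := (hφ.differentiable (by simp) (z + t • EuclideanSpace.single i 1)).hasFDerivAt
  have hl : HasDerivAt (fun s : ℝ => z + s • (EuclideanSpace.single i 1 : Pt n))
      (EuclideanSpace.single i 1) t := by
    simpa using ((hasDerivAt_id t).smul_const (EuclideanSpace.single i 1 : Pt n)).const_add z
  exact h.comp_hasDerivAt t hl

/-- At a local maximum the pure second partial derivatives are nonpositive. -/
lemma pd_pd_nonpos_of_isLocalMax (i : Fin n) {φ : Pt n → ℝ} (hφ : ContDiff ℝ ∞ φ) {z : Pt n}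
    (hz : IsLocalMax φ z) : pd i (pd i φ) z ≤ 0 := by
  by_contra! hpos
  set h : ℝ → ℝ := fun s => φ (z + s • EuclideanSpace.single i 1) with hh
  have hd : deriv h = fun t => pd i φ (z + t • EuclideanSpace.single i 1) :=
    funext fun t => (hasDerivAt_line i hφ z t).deriv
  have hdd : deriv (deriv h) 0 = pd i (pd i φ) z := by
    rw [hd, (hasDerivAt_line i (contDiff_pd i hφ) z 0).deriv]
    simp
  have hcont : ContinuousAt h 0 := (hasDerivAt_line i hφ z 0).continuousAt
  have hmax : IsLocalMax h 0 := by
    have hl : ContinuousAt (fun s : ℝ => z + s • (EuclideanSpace.single i 1 : Pt n)) 0 := by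
      fun_prop
    have h0 : (fun s : ℝ => z + s • (EuclideanSpace.single i 1 : Pt n)) 0 = z := by simp
    have hz' : IsLocalMax φ ((fun s : ℝ => z + s • (EuclideanSpace.single i 1 : Pt n)) 0) := by
      rwa [h0]
    exact hl.eventually hz'
  -- A positive second derivative makes `0` a local minimum as well, so `h` is locally constant and
  -- its second derivative is `0`.
  have hmin : IsLocalMin h 0 :=
    isLocalMin_of_deriv_deriv_pos (by rwa [hdd]) hmax.deriv_eq_zero hcont
  have hconst : h =ᶠ[𝓝 0] fun _ => h 0 := by
    filter_upwards [hmax, hmin] with t h1 h2 using le_antisymm h1 h2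
  have hdd0 : deriv (deriv h) 0 = 0 := by
    have h1 : deriv h =ᶠ[𝓝 0] fun _ => 0 := by
      simpa using hconst.deriv
    rw [h1.deriv_eq]
    simp
  rw [hdd] at hdd0
  exact hpos.ne' hdd0

lemma pd_norm_sq (i : Fin n) : pd i (fun x : Pt n => ‖x‖ ^ 2) = fun x => 2 * x i := by
  ext x
  simp only [pd]
  rw [(hasStrictFDerivAt_norm_sq x).hasFDerivAt.fderiv]
  simp [EuclideanSpace.inner_single_right]

lemma pd_coord (i : Fin n) : pd i (fun x : Pt n => 2 * x i) = fun _ => 2 := by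
  ext x
  have h : HasFDerivAt (fun x : Pt n => 2 * x i)
      ((2 : ℝ) • (EuclideanSpace.proj i : Pt n →L[ℝ] ℝ)) x :=
    ((EuclideanSpace.proj i : Pt n →L[ℝ] ℝ).hasFDerivAt).const_mul 2
  simp only [pd]
  rw [h.fderiv]
  simp

/-- Weak maximum principle on the whole space for harmonic functions vanishing at infinity. -/
lemma nonpos_of_harmonic_of_vanishes [NeZero n] {φ : Pt n → ℝ} (hφ : ContDiff ℝ ∞ φ)
    (hv : VanishesAtInfinity φ) (hΔ : ∀ x, ∑ i, pd i (pd i φ) x = 0) (x₀ : Pt n) : φ x₀ ≤ 0 := by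
  by_contra! hpos
  obtain ⟨R, hR⟩ : ∃ R : ℝ, ∀ x : Pt n, R < ‖x‖ → φ x < φ x₀ / 2 := by
    have h := hv.eventually (gt_mem_nhds (half_pos hpos))
    rw [← Metric.cobounded_eq_cocompact, ← comap_norm_atTop, eventually_comap] at h
    obtain ⟨R, hR⟩ := h.exists_forall_of_atTop
    exact ⟨R, fun x hx => hR _ hx.le x rfl⟩
  set r : ℝ := max R ‖x₀‖ + 1 with hr
  have hrR : R < r := by have := le_max_left R ‖x₀‖; linarith
  have hrx : ‖x₀‖ < r := by have := le_max_right R ‖x₀‖; linarith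
  have hr0 : 0 < r := (norm_nonneg _).trans_lt hrx
  -- Chosen so that `ε r² = φ x₀ / 2`: on the sphere of radius `r` this gives `ψ < φ x₀ ≤ ψ x₀`, so
  -- the maximum of `ψ` over the ball is interior. There the Laplacian of `ψ` would be `2nε > 0`.
  set ε : ℝ := φ x₀ / (2 * r ^ 2) with hε
  have hε0 : 0 < ε := by positivity
  set N : Pt n → ℝ := fun x => ‖x‖ ^ 2 with hN
  have hNc : ContDiff ℝ ∞ N := contDiff_norm_sq ℝ
  set ψ : Pt n → ℝ := φ + ε • N with hψ
  have hψc : ContDiff ℝ ∞ ψ := hφ.add (contDiff_const.smul hNc)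
  obtain ⟨z, hzmem, hz⟩ := (isCompact_closedBall (0 : Pt n) r).exists_isMaxOn
    ⟨x₀, by simpa using hrx.le⟩ hψc.continuous.continuousOn
  have hzx : φ x₀ ≤ ψ z := by
    have h1 : ψ x₀ ≤ ψ z := hz (by simpa using hrx.le)
    have h2 : φ x₀ ≤ ψ x₀ := by
      simp only [hψ, hN, Pi.add_apply, Pi.smul_apply, smul_eq_mul]
      nlinarith [mul_nonneg hε0.le (sq_nonneg ‖x₀‖)]
    exact h2.trans h1
  have hzr : ‖z‖ < r := by
    refine lt_of_le_of_ne (by simpa using hzmem) fun heq => ?_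
    have h1 := hR z (by rw [heq]; exact hrR)
    have h2 : ψ z = φ z + φ x₀ / 2 := by
      simp only [hψ, hN, Pi.add_apply, Pi.smul_apply, smul_eq_mul, heq, hε]
      field_simp
    linarith
  have hloc : IsLocalMax ψ z := hz.isLocalMax (Metric.closedBall_mem_nhds_of_mem (by simpa using hzr))
  have hsum : ∑ i, pd i (pd i ψ) z = ∑ i : Fin n, ε * 2 := by
    have h1 : ∀ i, pd i (pd i ψ) z = pd i (pd i φ) z + ε * 2 := by
      intro i
      have hεN : ContDiff ℝ ∞ (ε • N) := contDiff_const.smul hNc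
      have hεN' : ContDiff ℝ ∞ (ε • pd i N) := contDiff_const.smul (contDiff_pd i hNc)
      rw [hψ, pd_add i hφ hεN, pd_const_smul i ε hNc, pd_add i (contDiff_pd i hφ) hεN',
        pd_const_smul i ε (contDiff_pd i hNc), hN, pd_norm_sq, pd_coord]
      rfl
    rw [Finset.sum_congr rfl fun i _ => h1 i, Finset.sum_add_distrib, hΔ z, zero_add]
  have hle : ∑ i, pd i (pd i ψ) z ≤ 0 :=
    Finset.sum_nonpos fun i _ => pd_pd_nonpos_of_isLocalMax i hψc hloc
  rw [hsum] at hle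
  have : 0 < ∑ i : Fin n, ε * 2 :=
    Finset.sum_pos (fun _ _ => by positivity) ⟨0, Finset.mem_univ _⟩
  linarith

/-- A harmonic function vanishing at infinity is zero. -/
lemma eq_zero_of_harmonic_of_vanishes [NeZero n] {φ : Pt n → ℝ} (hφ : ContDiff ℝ ∞ φ)
    (hv : VanishesAtInfinity φ) (hΔ : ∀ x, ∑ i, pd i (pd i φ) x = 0) : φ = 0 := by
  ext x
  refine le_antisymm (nonpos_of_harmonic_of_vanishes hφ hv hΔ x) ?_
  have hneg : (-1 : ℝ) • φ = fun x => -φ x := by ext; simp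
  have h := nonpos_of_harmonic_of_vanishes (φ := (-1 : ℝ) • φ) (contDiff_const.smul hφ)
    (by rw [hneg]; simpa [VanishesAtInfinity] using hv.neg) (fun y => by
      have h1 : ∀ i, pd i (pd i ((-1 : ℝ) • φ)) y = - pd i (pd i φ) y := by
        intro i
        rw [pd_const_smul i _ hφ, pd_const_smul i _ (contDiff_pd i hφ)]
        simp
      rw [Finset.sum_congr rfl fun i _ => h1 i, Finset.sum_neg_distrib, hΔ y, neg_zero]) x
  simpa using h

end Calculus

/-! ### Weakly vanishing functions and injectivity of the Laplacian -/

section Mollification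

variable {n : ℕ}

open scoped Convolution
open ContinuousLinearMap (lsmul)

/-- The mollification of `φ` by `ρ`. -/
noncomputable def mollify (ρ φ : Pt n → ℝ) : Pt n → ℝ :=
  ρ ⋆[lsmul ℝ ℝ, volume] φ

lemma mollify_apply (ρ φ : Pt n → ℝ) (x : Pt n) : mollify ρ φ x = ∫ t, ρ t * φ (x - t) := rfl

lemma contDiff_mollify {ρ φ : Pt n → ℝ} (hρ : ContDiff ℝ ∞ ρ) (hcρ : HasCompactSupport ρ)
    (hφ : Continuous φ) : ContDiff ℝ ∞ (mollify ρ φ) :=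
  hcρ.contDiff_convolution_left _ hρ hφ.locallyIntegrable

lemma pd_mollify_left (i : Fin n) {ρ φ : Pt n → ℝ} (hρ : ContDiff ℝ ∞ ρ)
    (hcρ : HasCompactSupport ρ) (hφ : Continuous φ) :
    pd i (mollify ρ φ) = mollify (pd i ρ) φ := by
  ext x
  have h := hcρ.hasFDerivAt_convolution_left (lsmul ℝ ℝ : ℝ →L[ℝ] ℝ →L[ℝ] ℝ)
    (hρ.of_le (by exact_mod_cast le_top)) (hφ.locallyIntegrable (μ := volume)) x
  have hex : ConvolutionExistsAt (fderiv ℝ ρ) φ x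
      ((lsmul ℝ ℝ : ℝ →L[ℝ] ℝ →L[ℝ] ℝ).precompL (Pt n)) volume :=
    (hcρ.fderiv ℝ).convolutionExists_left _ (hρ.continuous_fderiv (by simp))
      hφ.locallyIntegrable x
  simp only [pd]
  rw [mollify, h.fderiv, convolution_def, ContinuousLinearMap.integral_apply hex, mollify_apply]
  rfl

/-- Integration by parts. The derivative lands on the test function, so no bound on `pd i φ` is
needed. -/
lemma pd_mollify_right (i : Fin n) {ρ φ : Pt n → ℝ} (hρ : ContDiff ℝ ∞ ρ)
    (hcρ : HasCompactSupport ρ) (hφ : ContDiff ℝ ∞ φ) :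
    mollify ρ (pd i φ) = mollify (pd i ρ) φ := by
  ext x
  simp only [mollify_apply]
  have hφx : ContDiff ℝ ∞ (fun t => φ (x - t)) := hφ.comp (contDiff_const.sub contDiff_id)
  have hd : ∀ t, fderiv ℝ (fun t => φ (x - t)) t (EuclideanSpace.single i 1)
      = - pd i φ (x - t) := by
    intro t
    have h1 := (hφ.differentiable (by simp) (x - t)).hasFDerivAt.comp t
      ((hasFDerivAt_const x t).sub (hasFDerivAt_id t))
    have h2 : fderiv ℝ (fun t => φ (x - t)) t = _ := h1.fderiv
    rw [h2]
    simp [pd]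
  have hint : ∀ {a b : Pt n → ℝ}, Continuous a → HasCompactSupport a → Continuous b →
      Integrable (fun t => a t * b t) := fun ha hca hb =>
    (ha.mul hb).integrable_of_hasCompactSupport hca.mul_right
  have key := integral_mul_fderiv_eq_neg_fderiv_mul_of_integrable (μ := (volume : Measure (Pt n)))
    (f := ρ) (g := fun t => φ (x - t)) (v := EuclideanSpace.single i 1)
    (hint (contDiff_pd i hρ).continuous (hasCompactSupport_pd i hcρ) hφx.continuous)
    (hint hρ.continuous hcρ (contDiff_pd i hφx).continuous)
    (hint hρ.continuous hcρ hφx.continuous)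
    (fun t _ => hρ.differentiable (by simp) t) (fun t _ => hφx.differentiable (by simp) t)
  simp only [hd, mul_neg, integral_neg, neg_inj] at key
  exact key

lemma mollify_add {ρ φ ψ : Pt n → ℝ} (hρ : Continuous ρ) (hcρ : HasCompactSupport ρ)
    (hφ : Continuous φ) (hψ : Continuous ψ) :
    mollify ρ (φ + ψ) = mollify ρ φ + mollify ρ ψ :=
  (hcρ.convolutionExists_left _ hρ hφ.locallyIntegrable).distrib_add
    (hcρ.convolutionExists_left _ hρ hψ.locallyIntegrable)

lemma mollify_smul {ρ φ : Pt n → ℝ} (c : ℝ) : mollify ρ (c • φ) = c • mollify ρ φ :=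
  convolution_smul

lemma mollify_zero {ρ : Pt n → ℝ} : mollify ρ 0 = 0 := convolution_zero

/-- Normed bumps with shrinking support form an approximate identity. -/
lemma eq_zero_of_mollify_eq_zero {φ : Pt n → ℝ} (hφ : Continuous φ)
    (h : ∀ ρ : Pt n → ℝ, ContDiff ℝ ∞ ρ → HasCompactSupport ρ → mollify ρ φ = 0) : φ = 0 := by
  ext x
  let b : ℕ → ContDiffBump (0 : Pt n) := fun k =>
    ⟨1 / (k + 2), 1 / (k + 1), by positivity, by gcongr; linarith⟩
  have hb : Tendsto (fun k => (b k).rOut) atTop (𝓝 0) := tendsto_one_div_add_atTop_nhds_zero_nat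
  have ht := ContDiffBump.convolution_tendsto_right_of_continuous (μ := volume) hb hφ x
  have h0 : ∀ k, ((b k).normed volume ⋆[lsmul ℝ ℝ, volume] φ) x = 0 := fun k =>
    congrFun (h _ (b k).contDiff_normed (b k).hasCompactSupport_normed) x
  simp only [h0] at ht
  exact (tendsto_nhds_unique ht tendsto_const_nhds)

/-- Smooth functions all of whose mollifications vanish at infinity. -/
noncomputable def WeaklyVanishing (n : ℕ) : Submodule ℝ (Pt n → ℝ) where
  carrier := {φ | ContDiff ℝ ∞ φ ∧ ∀ ρ : Pt n → ℝ, ContDiff ℝ ∞ ρ → HasCompactSupport ρ →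
    VanishesAtInfinity (mollify ρ φ)}
  add_mem' := by
    rintro φ ψ ⟨hφ, hφ'⟩ ⟨hψ, hψ'⟩
    refine ⟨hφ.add hψ, fun ρ hρ hcρ => ?_⟩
    rw [mollify_add hρ.continuous hcρ hφ.continuous hψ.continuous]
    simpa [VanishesAtInfinity] using! (hφ' ρ hρ hcρ).add (hψ' ρ hρ hcρ)
  zero_mem' := ⟨contDiff_const, fun ρ _ _ => by
    rw [mollify_zero]; exact tendsto_const_nhds⟩
  smul_mem' := by
    rintro c φ ⟨hφ, hφ'⟩
    refine ⟨contDiff_const.smul hφ, fun ρ hρ hcρ => ?_⟩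
    rw [mollify_smul]
    simpa [VanishesAtInfinity] using! (hφ' ρ hρ hcρ).const_mul c

/-- A continuous function vanishing at infinity is weakly vanishing. -/
lemma mem_weaklyVanishing {φ : Pt n → ℝ} (hφ : ContDiff ℝ ∞ φ) (hv : VanishesAtInfinity φ) :
    φ ∈ WeaklyVanishing n := by
  refine ⟨hφ, fun ρ hρ hcρ => ?_⟩
  have hbdd : ∃ C, ∀ x, ‖φ x‖ ≤ C := by
    let Z : ZeroAtInftyContinuousMap (Pt n) ℝ := ⟨⟨φ, hφ.continuous⟩, hv⟩
    exact ⟨‖Z.toBCF‖, fun x => Z.toBCF.norm_coe_le_norm x⟩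
  obtain ⟨C, hC⟩ := hbdd
  -- Dominated convergence along a filter requires it to be countably generated.
  have : (cocompact (Pt n)).IsCountablyGenerated := by
    rw [← Metric.cobounded_eq_cocompact, ← comap_norm_atTop]
    infer_instance
  have hρi : Integrable ρ := hρ.continuous.integrable_of_hasCompactSupport hcρ
  have h : Tendsto (fun x => ∫ t, ρ t * φ (x - t)) (cocompact (Pt n)) (𝓝 (∫ t, ρ t * 0)) := by
    refine tendsto_integral_filter_of_dominated_convergence (fun t => ‖ρ t‖ * C) ?_ ?_ ?_ ?_
    · refine Eventually.of_forall fun x => ?_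
      have := hρ.continuous
      have := hφ.continuous
      exact (by fun_prop : Continuous fun t => ρ t * φ (x - t)).aestronglyMeasurable
    · refine Eventually.of_forall fun x => Eventually.of_forall fun t => ?_
      rw [norm_mul]
      gcongr
      exact hC _
    · exact hρi.norm.mul_const C
    · refine Eventually.of_forall fun t => Tendsto.const_mul _ ?_
      have : Tendsto (fun x : Pt n => x - t) (cocompact _) (cocompact _) := by
        exact (Homeomorph.subRight t).isClosedEmbedding.tendsto_cocompact
      exact hv.comp this
  simpa [VanishesAtInfinity, mollify_apply] using! h

/-- The reason for testing against every `ρ`: the derivative of a test function is again a test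
function. -/
lemma pd_mem_weaklyVanishing (i : Fin n) {φ : Pt n → ℝ} (hφ : φ ∈ WeaklyVanishing n) :
    pd i φ ∈ WeaklyVanishing n := by
  refine ⟨contDiff_pd i hφ.1, fun ρ hρ hcρ => ?_⟩
  rw [pd_mollify_right i hρ hcρ hφ.1]
  exact hφ.2 _ (contDiff_pd i hρ) (hasCompactSupport_pd i hcρ)

/-- The partial derivative as an endomorphism of the weakly vanishing functions. -/
noncomputable def pdEnd (i : Fin n) : Module.End ℝ (WeaklyVanishing n) where
  toFun φ := ⟨pd i φ, pd_mem_weaklyVanishing i φ.2⟩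
  map_add' φ ψ := Subtype.ext (pd_add i φ.2.1 ψ.2.1)
  map_smul' c φ := Subtype.ext (pd_const_smul i c φ.2.1)

lemma coe_pdEnd (i : Fin n) (φ : WeaklyVanishing n) :
    ((pdEnd i φ : WeaklyVanishing n) : Pt n → ℝ) = pd i φ := rfl

lemma pdEnd_comm (i j : Fin n) : pdEnd i * pdEnd j = pdEnd j * pdEnd i := by
  ext1 φ
  exact Subtype.ext (pd_comm i j φ.2.1)

/-- Mollification commutes with derivatives, so each mollification is harmonic and vanishes at
infinity, hence is zero. -/
lemma eq_zero_of_laplacian_eq_zero [NeZero n] {φ : WeaklyVanishing n}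
    (h : ∑ i, pdEnd i (pdEnd i φ) = 0) : φ = 0 := by
  have hφ := φ.2.1
  have hsum : ∑ i, pd i (pd i (φ : Pt n → ℝ)) = 0 := by
    have := congrArg (fun ψ : WeaklyVanishing n => (ψ : Pt n → ℝ)) h
    simpa [Submodule.coe_sum, coe_pdEnd] using this
  refine Subtype.ext (eq_zero_of_mollify_eq_zero hφ.continuous fun ρ hρ hcρ => ?_)
  refine eq_zero_of_harmonic_of_vanishes (contDiff_mollify hρ hcρ hφ.continuous)
    (φ.2.2 ρ hρ hcρ) fun x => ?_
  have h1 : ∀ i, pd i (pd i (mollify ρ (φ : Pt n → ℝ))) = mollify ρ (pd i (pd i φ)) := by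
    intro i
    rw [pd_mollify_left i hρ hcρ hφ.continuous, ← pd_mollify_right i hρ hcρ hφ,
      pd_mollify_left i hρ hcρ (contDiff_pd i hφ).continuous,
      ← pd_mollify_right i hρ hcρ (contDiff_pd i hφ)]
  have h2 : ∀ s : Finset (Fin n), ∑ i ∈ s, mollify ρ (pd i (pd i (φ : Pt n → ℝ)))
      = mollify ρ (∑ i ∈ s, pd i (pd i (φ : Pt n → ℝ))) := by
    intro s
    induction s using Finset.cons_induction with
    | empty => simp [mollify_zero]
    | cons a s ha ih =>
      rw [Finset.sum_cons, Finset.sum_cons, ih, mollify_add hρ.continuous hcρ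
        (contDiff_pd a (contDiff_pd a hφ)).continuous]
      rw [Finset.sum_fn]
      exact continuous_finsetSum _ fun i _ => (contDiff_pd i (contDiff_pd i hφ)).continuous
  have h3 := congrFun (h2 Finset.univ) x
  rw [hsum, mollify_zero, Finset.sum_apply] at h3
  simpa only [h1, Pi.zero_apply] using h3

end Mollification

/-! ### Elimination over a commutative ring of derivations -/

section Algebra

variable {R M : Type*} [CommRing R] [AddCommGroup M] [Module R M]

/-- The decomposition equations for `g = -(Hv + Ku)` over a commutative ring containing the
derivations `D 0`, `D 1`, with coefficients cleared. -/
structure KernelEquations (D : Fin 2 → R) (v : Fin 2 → Fin 2 → M) (u : Fin 2 → M)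
    (g : Fin 2 → Fin 2 → Fin 2 → Fin 2 → M) : Prop where
  symm : v 0 1 = v 1 0
  eq : ∀ i j k l, (4 : R) • g i j k l + (2 : R) • ((D i * D j) • v k l + (D k * D l) • v i j)
    + ((if k = l then 1 else 0 : R) • (D i • u j + D j • u i)
      + (if i = j then 1 else 0 : R) • (D k • u l + D l • u k)) = 0
  kStar : ∀ i, ∑ k, ∑ j, D j • g i j k k = 0
  hStar : ∀ i j, ∑ k, ∑ l, (D k * D l) • g i j k l = 0

variable {D : Fin 2 → R} {v : Fin 2 → Fin 2 → M} {u : Fin 2 → M}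
  {g : Fin 2 → Fin 2 → Fin 2 → Fin 2 → M}

/-- The equations resulting from `H*(Hv + Ku) = 0` and `K*(Hv + Ku) = 0`. -/
theorem KernelEquations.adjoint_eqs (h : KernelEquations D v u g) {X Y : R} (hX : D 0 = X)
    (hY : D 1 = Y) {a b c p r s t d : M} (ha : v 0 0 = a) (hb : v 0 1 = b) (hc : v 1 1 = c)
    (hp : u 0 = p) (hr : u 1 = r) (hs : s = X ^ 2 • a + (2 * X * Y) • b + Y ^ 2 • c)
    (ht : t = a + c) (hd : d = X • p + Y • r) :
    ((2 : R) • (X ^ 2 + Y ^ 2) ^ 2 • a + (2 : R) • X ^ 2 • s +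
      (2 : R) • ((X ^ 2 + Y ^ 2) * X) • p + (2 : R) • (X ^ 2 + Y ^ 2) • d = 0) ∧
    ((2 : R) • (X ^ 2 + Y ^ 2) ^ 2 • b + (2 : R) • (X * Y) • s +
      (X ^ 2 + Y ^ 2) • (X • r + Y • p) = 0) ∧
    ((2 : R) • (X ^ 2 + Y ^ 2) ^ 2 • c + (2 : R) • Y ^ 2 • s +
      (2 : R) • ((X ^ 2 + Y ^ 2) * Y) • r + (2 : R) • (X ^ 2 + Y ^ 2) • d = 0) ∧
    ((2 : R) • ((X ^ 2 + Y ^ 2) * X) • t + (2 : R) • (X ^ 2 + Y ^ 2) • (X • a + Y • b) +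
      (2 : R) • (X ^ 2 + Y ^ 2) • p + (4 : R) • X • d = 0) ∧
    ((2 : R) • ((X ^ 2 + Y ^ 2) * Y) • t + (2 : R) • (X ^ 2 + Y ^ 2) • (X • b + Y • c) +
      (2 : R) • (X ^ 2 + Y ^ 2) • r + (4 : R) • Y • d = 0) := by
  obtain ⟨hsym, he, hK, hH⟩ := h
  have hb' : v 1 0 = b := by rw [← hsym, hb]
  have h00 := hH 0 0
  have h01 := hH 0 1
  have h11 := hH 1 1
  have k0 := hK 0
  have k1 := hK 1
  simp only [Fin.sum_univ_two, hX, hY] at h00 h01 h11 k0 k1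
  have e0000 := he 0 0 0 0
  have e0001 := he 0 0 0 1
  have e0010 := he 0 0 1 0
  have e0011 := he 0 0 1 1
  have e0100 := he 0 1 0 0
  have e0101 := he 0 1 0 1
  have e0110 := he 0 1 1 0
  have e0111 := he 0 1 1 1
  have e1000 := he 1 0 0 0
  have e1011 := he 1 0 1 1
  have e1100 := he 1 1 0 0
  have e1101 := he 1 1 0 1
  have e1110 := he 1 1 1 0
  have e1111 := he 1 1 1 1
  clear he hH hK
  simp only [hX, hY, ha, hb, hb', hc, hp, hr, if_true, zero_ne_one, one_ne_zero, if_false,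
    one_smul, zero_smul, zero_add, add_zero] at *
  subst hs ht hd
  refine ⟨?_, ?_, ?_, ?_, ?_⟩
  -- Applying `∂ₖ∂ₗ` to the equation for `4g_{ijkl}` and summing leaves only `v` and `u`, because
  -- `H*g = 0`. The last two goals use `∂ⱼ`, the trace over `k = l` and `K*g = 0`.
  · linear_combination (norm := module) (X ^ 2) • e0000 + (X * Y) • e0001 + (X * Y) • e0010 +
      (Y ^ 2) • e0011 - (4 : R) • h00
  · linear_combination (norm := module) (X ^ 2) • e0100 + (X * Y) • e0101 + (X * Y) • e0110 +
      (Y ^ 2) • e0111 - (4 : R) • h01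
  · linear_combination (norm := module) (X ^ 2) • e1100 + (X * Y) • e1101 + (X * Y) • e1110 +
      (Y ^ 2) • e1111 - (4 : R) • h11
  · linear_combination (norm := module) X • e0000 + X • e0011 + Y • e0100 + Y • e0111 -
      (4 : R) • k0
  · linear_combination (norm := module) X • e1000 + X • e1011 + Y • e1100 + Y • e1111 -
      (4 : R) • k1

/-- The equations `H*g = 0`, `K*g = 0` force `u` to be curl free and `v` to be a potential. -/
theorem KernelEquations.potential_eqs (h : KernelEquations D v u g)
    (hq : ∀ x : M, (D 0 ^ 2 + D 1 ^ 2) • x = 0 → x = 0) (h2 : ∀ x : M, (2 : R) • x = 0 → x = 0)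
    {X Y : R} (hX : D 0 = X)
    (hY : D 1 = Y) {a b c p r d : M} (ha : v 0 0 = a) (hb : v 0 1 = b) (hc : v 1 1 = c)
    (hp : u 0 = p) (hr : u 1 = r) (hd : d = X • p + Y • r) :
    X • r - Y • p = 0 ∧ (X ^ 2 + Y ^ 2) • a + d = 0 ∧ (X ^ 2 + Y ^ 2) • b = 0 ∧
      (X ^ 2 + Y ^ 2) • c + d = 0 := by
  obtain ⟨s, hs⟩ : ∃ s, s = X ^ 2 • a + (2 * X * Y) • b + Y ^ 2 • c := ⟨_, rfl⟩
  obtain ⟨t, ht⟩ : ∃ t, t = a + c := ⟨_, rfl⟩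
  obtain ⟨E1, E2, E3, F1, F2⟩ := h.adjoint_eqs hX hY ha hb hc hp hr hs ht hd
  rw [hX, hY] at hq
  clear h hX hY ha hb hc hp hr
  -- Contracting the `E` equations with `∂ᵢ∂ⱼ` gives `4Δ²(s + d) = 0`; their trace then gives `htd`.
  have hsd : s + d = 0 := h2 _ (h2 _ (hq _ (hq _ (by
    linear_combination (norm := skip) (X ^ 2) • E1 + (2 * X * Y) • E2 + (Y ^ 2) • E3
    subst hs hd
    module))))
  have htd : (X ^ 2 + Y ^ 2) • t + (2 : R) • d = 0 := h2 _ (hq _ (by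
    linear_combination (norm := skip) E1 + E3 - ((2 : R) * (X ^ 2 + Y ^ 2)) • hsd
    subst hs hd ht
    module))
  have hdiv1 : X • a + Y • b + p = 0 := h2 _ (hq _ (by
    linear_combination (norm := module) F1 - (2 * X) • htd))
  have hdiv2 : X • b + Y • c + r = 0 := h2 _ (hq _ (by
    linear_combination (norm := module) F2 - (2 * Y) • htd))
  -- Contraction of the `E` equations with `ξᵢξ⊥ⱼ` cancels `s` and `d`. Compared with the curl of
  -- `div v + u = 0`, it leaves `Δ² curl u = 0`.
  have hcurl : X • r - Y • p = 0 := hq _ (hq _ (by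
    linear_combination (norm := skip) (2 * (X ^ 2 + Y ^ 2) ^ 2) • (X • hdiv2 - Y • hdiv1) -
      ((-X * Y) • E1 + (X ^ 2 - Y ^ 2) • E2 + (X * Y) • E3)
    subst hd
    module))
  refine ⟨hcurl, h2 _ (hq _ ?_), h2 _ (hq _ ?_), h2 _ (hq _ ?_)⟩
  · linear_combination (norm := skip) E1 - (2 * X ^ 2) • hsd + (2 * X * Y) • hcurl
    subst hd
    module
  · linear_combination (norm := skip) E2 - (2 * X * Y) • hsd - (X ^ 2 - Y ^ 2) • hcurl
    subst hd
    module
  · linear_combination (norm := skip) E3 - (2 * Y ^ 2) • hsd - (2 * X * Y) • hcurl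
    subst hd
    module

/-- In the plane `Δu = ∇ div u + ∇⊥ curl u`, and the curl vanishes. -/
theorem KernelEquations.laplacian_u (h : KernelEquations D v u g)
    (hq : ∀ x : M, (D 0 ^ 2 + D 1 ^ 2) • x = 0 → x = 0) (h2 : ∀ x : M, (2 : R) • x = 0 → x = 0)
    (i : Fin 2) : (D 0 ^ 2 + D 1 ^ 2) • u i = D i • (D 0 • u 0 + D 1 • u 1) := by
  obtain ⟨hcurl, -⟩ := h.potential_eqs hq h2 rfl rfl rfl rfl rfl rfl rfl rfl
  match i with
  | 0 => linear_combination (norm := module) -D 1 • hcurl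
  | 1 => linear_combination (norm := module) D 0 • hcurl

theorem KernelEquations.laplacian_v (h : KernelEquations D v u g)
    (hq : ∀ x : M, (D 0 ^ 2 + D 1 ^ 2) • x = 0 → x = 0) (h2 : ∀ x : M, (2 : R) • x = 0 → x = 0)
    (i j : Fin 2) : (D 0 ^ 2 + D 1 ^ 2) • v i j +
      (if i = j then 1 else 0 : R) • (D 0 • u 0 + D 1 • u 1) = 0 := by
  obtain ⟨-, h00, h01, h11⟩ := h.potential_eqs hq h2 rfl rfl rfl rfl rfl rfl rfl rfl
  match i, j with
  | 0, 0 => simpa using h00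
  | 0, 1 => simpa using h01
  | 1, 0 => simpa [h.symm] using h01
  | 1, 1 => simpa using h11

/-- In `4Δg`, substitute `Δv_{ij} = -δ_{ij} div u` and `Δu = ∇ div u`: the second derivatives of
`div u` coming from `Hv` and from `Ku` cancel. -/
theorem KernelEquations.g_eq_zero (h : KernelEquations D v u g)
    (hq : ∀ x : M, (D 0 ^ 2 + D 1 ^ 2) • x = 0 → x = 0) (h2 : ∀ x : M, (2 : R) • x = 0 → x = 0)
    (i j k l : Fin 2) : g i j k l = 0 := by
  have hu := h.laplacian_u hq h2
  have hv := h.laplacian_v hq h2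
  have he := h.eq i j k l
  have hij := hv i j
  have hkl := hv k l
  have hi := hu i
  have hj := hu j
  have hk := hu k
  have hl := hu l
  revert he hij hkl
  generalize (if i = j then 1 else 0 : R) = δ
  generalize (if k = l then 1 else 0 : R) = δ'
  generalize D 0 • u 0 + D 1 • u 1 = d at *
  generalize D 0 ^ 2 + D 1 ^ 2 = q at *
  intro he hij hkl
  refine h2 _ (h2 _ (hq _ ?_))
  linear_combination (norm := module) q • he - (2 * (D i * D j)) • hkl - (2 * (D k * D l)) • hij -
    (δ' * D i) • hj - (δ' * D j) • hi - (δ * D k) • hl - (δ * D l) • hk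

theorem KernelEquations.u_eq_zero (h : KernelEquations D v u g)
    (hq : ∀ x : M, (D 0 ^ 2 + D 1 ^ 2) • x = 0 → x = 0) (h2 : ∀ x : M, (2 : R) • x = 0 → x = 0)
    (hd : D 0 • u 0 + D 1 • u 1 = 0) (i : Fin 2) : u i = 0 :=
  hq _ (by rw [h.laplacian_u hq h2, hd, smul_zero])

theorem KernelEquations.v_eq_zero (h : KernelEquations D v u g)
    (hq : ∀ x : M, (D 0 ^ 2 + D 1 ^ 2) • x = 0 → x = 0) (h2 : ∀ x : M, (2 : R) • x = 0 → x = 0)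
    (hd : D 0 • u 0 + D 1 • u 1 = 0) (i j : Fin 2) : v i j = 0 :=
  hq _ (by simpa [hd] using h.laplacian_v hq h2 i j)

end Algebra
-- Uniqueness of the decomposition
section Uniqueness

variable {n : ℕ}

lemma pd_sub (i : Fin n) {φ ψ : Pt n → ℝ} (hφ : ContDiff ℝ ∞ φ) (hψ : ContDiff ℝ ∞ ψ) :
    pd i (φ - ψ) = pd i φ - pd i ψ := by
  ext x
  simp only [pd, Pi.sub_apply]
  rw [fderiv_sub (hφ.differentiable (by simp) x) (hψ.differentiable (by simp) x)]
  rfl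

lemma pd_pd_sub (i j : Fin n) {φ ψ : Pt n → ℝ} (hφ : ContDiff ℝ ∞ φ) (hψ : ContDiff ℝ ∞ ψ) :
    pd i (pd j (φ - ψ)) = pd i (pd j φ) - pd i (pd j ψ) := by
  rw [pd_sub j hφ hψ, pd_sub i (contDiff_pd j hφ) (contDiff_pd j hψ)]

/-- The difference of two decompositions of the same field decomposes the zero field. -/
lemma IsDecomposition.sub {f : TensorField4 n} {v v' : TensorField2 n} {u u' : VectorField n}
    {g g' : TensorField4 n} (h : IsDecomposition f v u g) (h' : IsDecomposition f v' u' g') :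
    IsDecomposition 0 (v - v') (u - u') (g - g') where
  smooth_v i j := (h.smooth_v i j).sub (h'.smooth_v i j)
  smooth_u i := (h.smooth_u i).sub (h'.smooth_u i)
  smooth_g i j k l := (h.smooth_g i j k l).sub (h'.smooth_g i j k l)
  elastic_v i j := by simp only [Pi.sub_apply, h.elastic_v i j, h'.elastic_v i j]
  elastic_g i j k l := by
    simp only [Pi.sub_apply]
    obtain ⟨h1, h2, h3⟩ := h.elastic_g i j k l
    obtain ⟨h1', h2', h3'⟩ := h'.elastic_g i j k l
    exact ⟨by rw [h1, h1'], by rw [h2, h2'], by rw [h3, h3']⟩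
  eq_add i j k l x := by
    have e := h.eq_add i j k l x
    have e' := h'.eq_add i j k l x
    simp only [opH, opK, Pi.sub_apply] at e e' ⊢
    rw [pd_pd_sub i j (h.smooth_v k l) (h'.smooth_v k l),
      pd_pd_sub k l (h.smooth_v i j) (h'.smooth_v i j), pd_sub i (h.smooth_u j) (h'.smooth_u j),
      pd_sub j (h.smooth_u i) (h'.smooth_u i), pd_sub k (h.smooth_u l) (h'.smooth_u l),
      pd_sub l (h.smooth_u k) (h'.smooth_u k)]
    simp only [Pi.sub_apply, Pi.zero_apply]
    linear_combination e - e'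
  kStar_g i x := by
    have e := h.kStar_g i x
    have e' := h'.kStar_g i x
    simp only [opKStar, neg_eq_zero] at e e' ⊢
    refine Eq.trans ?_ ((congrArg₂ (· - ·) e e').trans (sub_zero 0))
    rw [← Finset.sum_sub_distrib]
    refine Finset.sum_congr rfl fun k _ => ?_
    rw [← Finset.sum_sub_distrib]
    exact Finset.sum_congr rfl fun j _ =>
      congrFun (pd_sub j (h.smooth_g i j k k) (h'.smooth_g i j k k)) x
  hStar_g i j x := by
    have e := h.hStar_g i j x
    have e' := h'.hStar_g i j x
    simp only [opHStar] at e e' ⊢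
    refine Eq.trans ?_ ((congrArg₂ (· - ·) e e').trans (sub_zero 0))
    rw [← Finset.sum_sub_distrib]
    refine Finset.sum_congr rfl fun k _ => ?_
    rw [← Finset.sum_sub_distrib]
    exact Finset.sum_congr rfl fun l _ =>
      congrFun (pd_pd_sub k l (h.smooth_g i j k l) (h'.smooth_g i j k l)) x

open scoped IsMulCommutative in
/-- A module over a ring is a module over a commutative ring containing given commuting elements. -/
lemma exists_commRing_of_commute {A M ι : Type} [Ring A] [Algebra ℝ A] [AddCommGroup M]
    [Module A M] (d : ι → A) (hd : ∀ i j, d i * d j = d j * d i) :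
    ∃ (R : Type) (_ : CommRing R) (_ : Module R M) (D : ι → R),
      ∀ i (x : M), D i • x = d i • x := by
  have hcomm : ∀ a ∈ Set.range d, ∀ b ∈ Set.range d, a * b = b * a := by
    rintro _ ⟨i, rfl⟩ _ ⟨j, rfl⟩
    exact hd i j
  have := Algebra.isMulCommutative_adjoin ℝ hcomm
  exact ⟨Algebra.adjoin ℝ (Set.range d), inferInstance, inferInstance,
    fun i => ⟨d i, Algebra.subset_adjoin ⟨i, rfl⟩⟩, fun _ _ => rfl⟩

/-- The weakly vanishing functions are a module over a commutative ring containing the partial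
derivatives. -/
lemma exists_commRing_pdEnd : ∃ (R : Type) (_ : CommRing R) (_ : Module R (WeaklyVanishing n))
    (D : Fin n → R), ∀ i (φ : WeaklyVanishing n), D i • φ = pdEnd i φ :=
  exists_commRing_of_commute (A := Module.End ℝ (WeaklyVanishing n)) pdEnd pdEnd_comm

/-- A decomposition of the zero field into fields vanishing at infinity has no solenoidal part,
and is trivial if its vector field is divergence free. -/
theorem IsDecomposition.eq_zero {v : TensorField2 2} {u : VectorField 2} {g : TensorField4 2}
    (h : IsDecomposition 0 v u g) (hv : ∀ i j, VanishesAtInfinity (v i j))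
    (hu : ∀ i, VanishesAtInfinity (u i)) :
    g = 0 ∧ ((∀ x, divergence u x = 0) → v = 0 ∧ u = 0) := by
  obtain ⟨R, _, _, D, hD⟩ := exists_commRing_pdEnd (n := 2)
  let V : Fin 2 → Fin 2 → WeaklyVanishing 2 := fun i j =>
    ⟨v i j, mem_weaklyVanishing (h.smooth_v i j) (hv i j)⟩
  let U : Fin 2 → WeaklyVanishing 2 := fun i => ⟨u i, mem_weaklyVanishing (h.smooth_u i) (hu i)⟩
  have hg : ∀ i j k l, g i j k l = -((1 / 2 : ℝ) • (pd i (pd j (v k l)) + pd k (pd l (v i j)))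
      + ((1 / 4 * kron k l) • (pd i (u j) + pd j (u i))
        + (1 / 4 * kron i j) • (pd k (u l) + pd l (u k)))) := by
    intro i j k l
    ext x
    have e := h.eq_add i j k l x
    simp only [opH, opK, Pi.zero_apply, Pi.neg_apply, Pi.add_apply, Pi.smul_apply,
      smul_eq_mul] at e ⊢
    linear_combination -e
  -- `g` is a combination of derivatives of `v` and `u`, so it needs no decay assumption of its own.
  have hgm : ∀ i j k l, g i j k l ∈ WeaklyVanishing 2 := by
    intro i j k l
    have hvm := fun a b i j => pd_mem_weaklyVanishing a (pd_mem_weaklyVanishing b (V i j).2)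
    have hum := fun a i => pd_mem_weaklyVanishing a (U i).2
    rw [hg]
    refine neg_mem (add_mem (Submodule.smul_mem _ _ (add_mem (hvm _ _ _ _) (hvm _ _ _ _)))
      (add_mem (Submodule.smul_mem _ _ (add_mem (hum _ _) (hum _ _)))
        (Submodule.smul_mem _ _ (add_mem (hum _ _) (hum _ _)))))
  let G : Fin 2 → Fin 2 → Fin 2 → Fin 2 → WeaklyVanishing 2 := fun i j k l =>
    ⟨g i j k l, hgm i j k l⟩
  have h2' : ∀ x : WeaklyVanishing 2, (2 : R) • x = (2 : ℝ) • x := fun x => by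
    rw [two_smul, two_smul]
  have h4' : ∀ x : WeaklyVanishing 2, (4 : R) • x = (4 : ℝ) • x := fun x => by
    rw [show (4 : R) = 2 + 2 by norm_num, show (4 : ℝ) = 2 + 2 by norm_num, add_smul, add_smul,
      h2']
  have hite : ∀ (p : Prop) [Decidable p] (x : WeaklyVanishing 2),
      (if p then 1 else 0 : R) • x = (if p then 1 else 0 : ℝ) • x := by
    intro p _ x
    split_ifs <;> simp
  have hK : KernelEquations D V U G := by
    refine ⟨Subtype.ext (h.elastic_v 0 1), fun i j k l => ?_, fun i => ?_, fun i j => ?_⟩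
    · simp only [h2', h4', hite, mul_smul, hD]
      refine Subtype.ext ?_
      simp only [Submodule.coe_add, Submodule.coe_smul, coe_pdEnd, Submodule.coe_zero, G, U, V, hg]
      ext x
      simp only [Pi.zero_apply, Pi.neg_apply, Pi.add_apply, Pi.smul_apply, smul_eq_mul, kron]
      ring
    · refine Subtype.ext ?_
      ext x
      have e := h.kStar_g i x
      simp only [opKStar, neg_eq_zero] at e
      simpa [Fin.sum_univ_two, hD, coe_pdEnd, G] using e
    · refine Subtype.ext ?_
      ext x
      simpa [opHStar, Fin.sum_univ_two, hD, coe_pdEnd, G, mul_smul] using h.hStar_g i j x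
  have hq : ∀ x : WeaklyVanishing 2, (D 0 ^ 2 + D 1 ^ 2) • x = 0 → x = 0 := by
    intro x hx
    refine eq_zero_of_laplacian_eq_zero ?_
    rw [Fin.sum_univ_two]
    rwa [add_smul, pow_two, pow_two, mul_smul, mul_smul, hD, hD, hD, hD] at hx
  have h2 : ∀ x : WeaklyVanishing 2, (2 : R) • x = 0 → x = 0 := by
    intro x hx
    rw [h2'] at hx
    exact (smul_eq_zero.1 hx).resolve_left two_ne_zero
  refine ⟨?_, fun hdiv => ?_⟩
  · funext i j k l
    exact congrArg Subtype.val (hK.g_eq_zero hq h2 i j k l)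
  · have hd : D 0 • U 0 + D 1 • U 1 = 0 := by
      refine Subtype.ext ?_
      ext x
      simpa [divergence, Fin.sum_univ_two, hD, coe_pdEnd, U] using hdiv x
    refine ⟨?_, ?_⟩
    · funext i j
      exact congrArg Subtype.val (hK.v_eq_zero hq h2 hd i j)
    · funext i
      exact congrArg Subtype.val (hK.u_eq_zero hq h2 hd i)

end Uniqueness

/-! ### Fields as Fourier transforms of rapidly integrable symbols -/

section Symbols

open Complex (I)
open scoped FourierTransform Real

variable {n : ℕ}

/-- Functions that are integrable against all polynomial weights. -/
def RapidlyIntegrable (V : Pt n → ℂ) : Prop :=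
  AEStronglyMeasurable V volume ∧ ∀ k : ℕ, Integrable (fun y => ‖y‖ ^ k * ‖V y‖)

lemma RapidlyIntegrable.integrable {V : Pt n → ℂ} (hV : RapidlyIntegrable V) : Integrable V := by
  have := hV.2 0
  simp only [pow_zero, one_mul] at this
  exact (integrable_norm_iff hV.1).1 this

lemma RapidlyIntegrable.add {V W : Pt n → ℂ} (hV : RapidlyIntegrable V)
    (hW : RapidlyIntegrable W) : RapidlyIntegrable (fun y => V y + W y) := by
  refine ⟨hV.1.add hW.1, fun k => ((hV.2 k).add (hW.2 k)).mono'
    (.mul (by fun_prop) (hV.1.add hW.1).norm) (Eventually.of_forall fun y => ?_)⟩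
  simp only [norm_mul, norm_pow, norm_norm, Pi.add_apply]
  rw [← mul_add]
  gcongr
  exact norm_add_le _ _

/-- Multiplication by measurable functions of at most linear growth. -/
lemma RapidlyIntegrable.mul_left {V m : Pt n → ℂ} (hV : RapidlyIntegrable V) (hm : Measurable m)
    {C : ℝ} (hC : ∀ y, ‖m y‖ ≤ C * (1 + ‖y‖)) : RapidlyIntegrable (fun y => m y * V y) := by
  have hmeas : AEStronglyMeasurable (fun y => m y * V y) volume :=
    hm.aestronglyMeasurable.mul hV.1
  refine ⟨hmeas, fun k => (((hV.2 k).add (hV.2 (k + 1))).const_mul C).mono'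
    (.mul (by fun_prop) hmeas.norm) (Eventually.of_forall fun y => ?_)⟩
  simp only [norm_mul, norm_pow, norm_norm, Pi.add_apply]
  calc ‖y‖ ^ k * (‖m y‖ * ‖V y‖) ≤ ‖y‖ ^ k * ((C * (1 + ‖y‖)) * ‖V y‖) := by
        gcongr
        exact hC y
    _ = C * (‖y‖ ^ k * ‖V y‖ + ‖y‖ ^ (k + 1) * ‖V y‖) := by ring

lemma RapidlyIntegrable.mul_left_of_bounded {V m : Pt n → ℂ} (hV : RapidlyIntegrable V)
    (hm : Measurable m) {C : ℝ} (hC : ∀ y, ‖m y‖ ≤ C) : RapidlyIntegrable (fun y => m y * V y) :=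
  hV.mul_left hm (C := C) fun y => (hC y).trans <|
    le_mul_of_one_le_right ((norm_nonneg _).trans (hC y)) (by linarith [norm_nonneg y])

lemma RapidlyIntegrable.const_mul {V : Pt n → ℂ} (hV : RapidlyIntegrable V) (c : ℂ) :
    RapidlyIntegrable (fun y => c * V y) :=
  hV.mul_left_of_bounded measurable_const (C := ‖c‖) fun _ => le_rfl

lemma RapidlyIntegrable.sum {ι : Type*} [Fintype ι] {V : ι → Pt n → ℂ}
    (hV : ∀ i, RapidlyIntegrable (V i)) : RapidlyIntegrable (fun y => ∑ i, V i y) := by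
  have h : ∀ s : Finset ι, RapidlyIntegrable (fun y => ∑ i ∈ s, V i y) := by
    intro s
    induction s using Finset.cons_induction with
    | empty => simp [RapidlyIntegrable, aestronglyMeasurable_const]
    | cons a s ha ih => simpa only [Finset.sum_cons] using (hV a).add ih
  exact h _

/-- The Fourier symbol of `∂/∂xᵢ`. -/
noncomputable def xi (i : Fin n) (y : Pt n) : ℂ := -(2 * π * I) * (y i : ℝ)

lemma measurable_xi (i : Fin n) : Measurable (xi i) := by
  have : Continuous (xi i) := by unfold xi; fun_prop
  exact this.measurable

lemma norm_xi_le (i : Fin n) (y : Pt n) : ‖xi i y‖ ≤ 2 * π * ‖y‖ := by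
  rw [xi, norm_mul]
  simp only [norm_neg, norm_mul, Complex.norm_ofNat, Complex.norm_real, Complex.norm_I, mul_one,
    Real.norm_of_nonneg Real.pi_pos.le]
  gcongr
  exact PiLp.norm_apply_le y i

lemma RapidlyIntegrable.xi_mul {V : Pt n → ℂ} (hV : RapidlyIntegrable V) (i : Fin n) :
    RapidlyIntegrable (fun y => xi i y * V y) :=
  hV.mul_left (measurable_xi i) (C := 2 * π) fun y => (norm_xi_le i y).trans (by
    gcongr
    linarith)

/-- `φ` is the real part of the Fourier transform of the rapidly integrable function `V`. -/
structure HasSymbol (φ : Pt n → ℝ) (V : Pt n → ℂ) : Prop where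
  rapid : RapidlyIntegrable V
  eq : ∀ x, φ x = (𝓕 V x).re

lemma RapidlyIntegrable.hasSymbol {V : Pt n → ℂ} (hV : RapidlyIntegrable V) :
    HasSymbol (fun x => (𝓕 V x).re) V := ⟨hV, fun _ => rfl⟩

variable {φ ψ : Pt n → ℝ} {V W : Pt n → ℂ}

lemma HasSymbol.contDiff (h : HasSymbol φ V) : ContDiff ℝ ∞ φ := by
  have h1 : ContDiff ℝ ∞ (𝓕 V) := Real.contDiff_fourier fun k _ => h.rapid.2 k
  rw [show φ = fun x => (𝓕 V x).re from funext h.eq]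
  exact Complex.reCLM.contDiff.comp h1

lemma HasSymbol.vanishesAtInfinity (h : HasSymbol φ V) : VanishesAtInfinity φ := by
  rw [show φ = fun x => (𝓕 V x).re from funext h.eq]
  have h1 : Tendsto (𝓕 V) (cocompact (Pt n)) (𝓝 0) := tendsto_integral_exp_inner_smul_cocompact V
  exact (Complex.continuous_re.tendsto 0).comp h1

lemma HasSymbol.add (h : HasSymbol φ V) (h' : HasSymbol ψ W) :
    HasSymbol (fun x => φ x + ψ x) (fun y => V y + W y) := by
  refine ⟨h.rapid.add h'.rapid, fun x => ?_⟩
  rw [h.eq, h'.eq, ← Complex.add_re]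
  congr 1
  simp only [Real.fourier_eq]
  rw [← integral_add ((Real.fourierIntegral_convergent_iff x).2 h.rapid.integrable)
    ((Real.fourierIntegral_convergent_iff x).2 h'.rapid.integrable)]
  simp only [smul_add]

lemma HasSymbol.const_mul (h : HasSymbol φ V) (c : ℝ) :
    HasSymbol (fun x => c * φ x) (fun y => (c : ℂ) * V y) := by
  refine ⟨h.rapid.const_mul c, fun x => ?_⟩
  rw [h.eq, ← Complex.re_ofReal_mul]
  congr 1
  simp only [Real.fourier_eq]
  rw [← integral_const_mul]
  congr 1
  ext y
  rw [mul_smul_comm]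

lemma HasSymbol.sum {ι : Type*} [Fintype ι] {φ : ι → Pt n → ℝ} {V : ι → Pt n → ℂ}
    (h : ∀ i, HasSymbol (φ i) (V i)) : HasSymbol (fun x => ∑ i, φ i x) (fun y => ∑ i, V i y) := by
  have key : ∀ s : Finset ι, HasSymbol (fun x => ∑ i ∈ s, φ i x) (fun y => ∑ i ∈ s, V i y) := by
    intro s
    induction s using Finset.cons_induction with
    | empty =>
      refine ⟨by simp [RapidlyIntegrable, aestronglyMeasurable_const], fun x => ?_⟩
      simp [Real.fourier_eq]
    | cons a s ha ih => simpa only [Finset.sum_cons] using (h a).add ih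
  exact key _

/-- Differentiation under the integral. The field is the forward transform of its symbol, whence the
minus sign in `xi`. -/
lemma HasSymbol.pd (h : HasSymbol φ V) (i : Fin n) :
    HasSymbol (pd i φ) (fun y => xi i y * V y) := by
  refine ⟨h.rapid.xi_mul i, fun x => ?_⟩
  have h1 : Integrable (fun y => ‖y‖ * ‖V y‖) := by simpa using h.rapid.2 1
  have hd := Real.hasFDerivAt_fourier h.rapid.integrable h1 x
  have hre := Complex.reCLM.hasFDerivAt.comp x hd
  have hφ : φ = Complex.reCLM ∘ 𝓕 V := funext h.eq
  have hint : Integrable (VectorFourier.fourierSMulRight (innerSL ℝ) V) := by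
    refine (h1.const_mul (2 * π * ‖(innerSL ℝ : Pt n →L[ℝ] Pt n →L[ℝ] ℝ)‖)).mono'
      h.rapid.1.fourierSMulRight (Eventually.of_forall fun y => ?_)
    rw [← mul_assoc]
    exact VectorFourier.norm_fourierSMulRight_le _ _ _
  rw [Elastic.pd, hφ, hre.fderiv]
  simp only [ContinuousLinearMap.comp_apply, Complex.reCLM_apply]
  rw [Real.fourier_continuousLinearMap_apply hint]
  refine congrArg (fun W : Pt n → ℂ => (𝓕 W x).re) (funext fun y => ?_)
  have hin : innerSL ℝ y (EuclideanSpace.single i 1) = y i := by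
    rw [innerSL_apply_apply, EuclideanSpace.inner_single_right]
    simp
  rw [VectorFourier.fourierSMulRight_apply, hin, xi, Complex.real_smul, smul_eq_mul]
  ring

lemma HasSymbol.eq_zero (h : HasSymbol φ V) (hV : ∀ y, V y = 0) (x : Pt n) : φ x = 0 := by
  rw [h.eq, show V = fun _ => 0 from funext hV]
  simp [Real.fourier_eq]

/-- The inverse Fourier transform of a real Schwartz function. -/
noncomputable def symbolOf (f : 𝓢(Pt n, ℝ)) : 𝓢(Pt n, ℂ) :=
  𝓕⁻ (f.postcompCLM Complex.ofRealCLM)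

lemma hasSymbol_symbolOf (f : 𝓢(Pt n, ℝ)) : HasSymbol f (symbolOf f) := by
  refine ⟨⟨(symbolOf f).continuous.aestronglyMeasurable,
    fun k => (symbolOf f).integrable_pow_mul volume k⟩, fun x => ?_⟩
  rw [← SchwartzMap.fourier_coe, symbolOf, FourierTransform.fourier_fourierInv_eq]
  simp

lemma symbolOf_zero {f : 𝓢(Pt n, ℝ)} (hf : ∫ x, f x = 0) : symbolOf f 0 = 0 := by
  rw [symbolOf, SchwartzMap.fourierInv_coe, Real.fourierInv_eq]
  simp [integral_complex_ofReal, hf]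

/-- Division by `‖y‖²` of a Schwartz function on the plane vanishing at the origin. -/
lemma rapidlyIntegrable_div_norm_sq (F : 𝓢(Pt 2, ℂ)) (hF : F 0 = 0) :
    RapidlyIntegrable (fun y => F y / ((‖y‖ ^ 2 : ℝ) : ℂ)) := by
  have hmeas : AEStronglyMeasurable (fun y => F y / ((‖y‖ ^ 2 : ℝ) : ℂ)) volume := by
    have := F.continuous.measurable
    exact (by fun_prop : Measurable (fun y => F y / ((‖y‖ ^ 2 : ℝ) : ℂ))).aestronglyMeasurable
  refine ⟨hmeas, fun k => ?_⟩
  -- Mean value inequality from `F 0 = 0` and the bounded derivative.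
  obtain ⟨C₀, hC₀⟩ : ∃ C, ∀ y, ‖F y‖ ≤ C * ‖y‖ := by
    obtain ⟨C, hC, h⟩ := F.decay 0 1
    refine ⟨C, fun y => ?_⟩
    have h1 := Convex.norm_image_sub_le_of_norm_fderiv_le (𝕜 := ℝ) (f := F) (C := C)
      (s := Set.univ) (x := 0) (y := y) (fun z _ => F.differentiable z)
      (fun z _ => by simpa [norm_iteratedFDeriv_one] using h z) convex_univ trivial trivial
    simpa [hF] using h1
  obtain ⟨C₁, hC₁0, hC₁⟩ := F.decay (k + 1) 0
  obtain ⟨C₂, hC₂0, hC₂⟩ := F.decay (k + 3) 0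
  have hC₀0 : 0 ≤ C₀ := by
    have h1 := hC₀ (EuclideanSpace.single 0 1)
    simp only [PiLp.norm_single, norm_one, mul_one] at h1
    exact (norm_nonneg _).trans h1
  simp only [norm_iteratedFDeriv_zero] at hC₁ hC₂
  -- `2C₀` serves the unit ball, where `1 + |y|² ≤ 2`; `C₁ + C₂` serves its complement.
  set K : ℝ := 2 * C₀ + C₁ + C₂ with hK
  have hbound : Integrable (fun y : Pt 2 => K * (‖y‖⁻¹ * (1 + ‖y‖ ^ 2)⁻¹)) := by
    refine Integrable.const_mul ?_ K
    -- In polar coordinates the planar Jacobian `r` cancels `r⁻¹`, leaving `(1 + r²)⁻¹`.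
    rw [integrable_fun_norm_addHaar volume (f := fun r : ℝ => r⁻¹ * (1 + r ^ 2)⁻¹)]
    refine (integrable_inv_one_add_sq.integrableOn (s := Set.Ioi 0)).congr_fun (fun r hr => ?_)
      measurableSet_Ioi
    have hr' : r ≠ 0 := (Set.mem_Ioi.1 hr).ne'
    simp [hr']
  refine hbound.mono' (.mul (by fun_prop) hmeas.norm) (Eventually.of_forall fun y => ?_)
  rcases eq_or_ne y 0 with rfl | hy
  · simp
  have hy0 : 0 < ‖y‖ := norm_pos_iff.2 hy
  have hmain : ‖y‖ ^ k * ‖F y‖ * (1 + ‖y‖ ^ 2) ≤ K * ‖y‖ := by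
    rcases le_total ‖y‖ 1 with h1 | h1
    · calc ‖y‖ ^ k * ‖F y‖ * (1 + ‖y‖ ^ 2) ≤ 1 * (C₀ * ‖y‖) * (1 + 1) := by
            gcongr
            · exact pow_le_one₀ hy0.le h1
            · exact hC₀ y
            · exact pow_le_one₀ hy0.le h1
        _ ≤ K * ‖y‖ := by rw [hK]; nlinarith
    · have e1 : ‖y‖ ^ k * ‖F y‖ ≤ C₁ := by
        refine le_trans ?_ (hC₁ y)
        gcongr
        omega
      have e2 : ‖y‖ ^ k * ‖F y‖ * ‖y‖ ^ 2 ≤ C₂ := by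
        refine le_trans ?_ (hC₂ y)
        calc ‖y‖ ^ k * ‖F y‖ * ‖y‖ ^ 2 = ‖y‖ ^ (k + 2) * ‖F y‖ := by ring
          _ ≤ _ := by
            gcongr
            norm_num
      have hK1 : C₁ + C₂ ≤ K := by rw [hK]; linarith
      have hK0 : 0 ≤ K := by linarith
      nlinarith
  have e : ‖‖y‖ ^ k * ‖F y / ((‖y‖ ^ 2 : ℝ) : ℂ)‖‖ =
      (‖y‖ ^ k * ‖F y‖ * (1 + ‖y‖ ^ 2)) / (‖y‖ ^ 2 * (1 + ‖y‖ ^ 2)) := by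
    rw [norm_mul, norm_pow, norm_norm, norm_norm, norm_div, Complex.norm_real, norm_pow, norm_norm]
    have : (1 + ‖y‖ ^ 2) ≠ 0 := by positivity
    field_simp
  rw [e, div_le_iff₀ (by positivity)]
  refine hmain.trans (le_of_eq ?_)
  have : (1 + ‖y‖ ^ 2) ≠ 0 := by positivity
  field_simp

end Symbols

/-! ### Explicit solution on the Fourier side -/

section SymbolAlgebra

/-- The rotation of a vector by a right angle. -/
def rot (ξ : Fin 2 → ℂ) : Fin 2 → ℂ := ![-ξ 1, ξ 0]

/-- The symbol of the Laplacian. -/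
def lapSym (ξ : Fin 2 → ℂ) : ℂ := ξ 0 ^ 2 + ξ 1 ^ 2

/-- `ξᵢ ξⱼ / (ξ · ξ)`. -/
noncomputable def parSym (ξ : Fin 2 → ℂ) (i j : Fin 2) : ℂ := ξ i * ξ j / lapSym ξ

/-- `ξᵢ ξ⊥ⱼ / (ξ · ξ)`. -/
noncomputable def rotSym (ξ : Fin 2 → ℂ) (i j : Fin 2) : ℂ := ξ i * rot ξ j / lapSym ξ

variable (ξ : Fin 2 → ℂ) (G : Fin 2 → Fin 2 → Fin 2 → Fin 2 → ℂ)

/-- The symbol of `Δ⁻² H*f`, where `G` is the symbol of `Δ⁻¹ f`. -/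
noncomputable def hStarSym (i j : Fin 2) : ℂ := ∑ k, ∑ l, parSym ξ k l * G i j k l

/-- The symbol of `Δ⁻¹ curl u`. -/
noncomputable def curlSym : ℂ :=
  4 * ((∑ i, ∑ j, ∑ k, rotSym ξ j i * G i j k k)
    + (-1) * ∑ i, ∑ j, rotSym ξ i j * hStarSym ξ G i j)

/-- The symbol of the solution `u`. -/
noncomputable def uSym (i : Fin 2) : ℂ := rot ξ i * curlSym ξ G

/-- The symbol of the solution `v`. -/
noncomputable def vSym (i j : Fin 2) : ℂ :=
  2 * hStarSym ξ G i j + (-1) * (parSym ξ i j * ∑ k, ∑ l, parSym ξ k l * hStarSym ξ G k l)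
    + (-1 / 2) * (rotSym ξ i j * curlSym ξ G + rotSym ξ j i * curlSym ξ G)

/-- The symbol of the solenoidal part. -/
noncomputable def gSym (i j k l : Fin 2) : ℂ :=
  lapSym ξ * G i j k l
    - ((1 / 2) * (ξ i * (ξ j * vSym ξ G k l) + ξ k * (ξ l * vSym ξ G i j))
      + ((1 / 4) * (ξ i * uSym ξ G j + ξ j * uSym ξ G i) * (kron k l : ℝ)
        + (1 / 4) * (ξ k * uSym ξ G l + ξ l * uSym ξ G k) * (kron i j : ℝ)))

variable {ξ G}

lemma sum_mul_uSym : ∑ i, ξ i * uSym ξ G i = 0 := by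
  simp only [Fin.sum_univ_two, uSym, rot, Matrix.cons_val_zero, Matrix.cons_val_one]
  ring

lemma vSym_symm (hG : ∀ i j k l, G i j k l = G j i k l) (i j : Fin 2) :
    vSym ξ G i j = vSym ξ G j i := by
  have h1 : hStarSym ξ G i j = hStarSym ξ G j i := by simp only [hStarSym, hG i j]
  have h2 : parSym ξ i j = parSym ξ j i := by simp only [parSym, mul_comm]
  rw [vSym, vSym, h1, h2, add_comm (rotSym ξ i j * _)]

/-- `curlSym` comes from eliminating `v` between the `ξ⊥` component of the `K*` equation and the
`ξξ⊥` component of the `H*` equation. The `ξ` component of `K*g` is, up to sign, the trace of `H*g`.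
The hypothesis `hq` excludes nonzero isotropic complex vectors. -/
lemma sum_mul_gSym (hq : lapSym ξ ≠ 0 ∨ ξ = 0)
    (h1 : ∀ i j k l, G i j k l = G j i k l) (h2 : ∀ i j k l, G i j k l = G i j l k)
    (h3 : ∀ i j k l, G i j k l = G k l i j) (i : Fin 2) :
    ∑ k, ∑ j, ξ j * gSym ξ G i j k k = 0 := by
  rcases hq with hq | rfl
  swap
  · simp
  obtain rfl | rfl : i = 0 ∨ i = 1 := by omega
  all_goals
    -- These instances of the symmetries reduce `G` to its six independent components; `lapSym`
    -- stays opaque until denominators are cleared.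
    simp only [Fin.sum_univ_two, gSym, vSym, uSym, curlSym, hStarSym, rotSym, parSym, rot, kron,
      Matrix.cons_val_zero, Matrix.cons_val_one, h1 1 0, h2 _ _ 1 0, h3 0 1 0 0, h3 1 1 0 0,
      h3 1 1 0 1, if_true, zero_ne_one, one_ne_zero, if_false, Complex.ofReal_zero,
      Complex.ofReal_one]
    field_simp
    simp only [lapSym]
    ring

-- `vSym` is the `H*` equation solved for `v`, the double divergence of `v` having been found by
-- contraction with `ξξ`.
set_option maxHeartbeats 1000000 in
lemma sum_mul_mul_gSym (hq : lapSym ξ ≠ 0 ∨ ξ = 0)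
    (h1 : ∀ i j k l, G i j k l = G j i k l) (h2 : ∀ i j k l, G i j k l = G i j l k)
    (h3 : ∀ i j k l, G i j k l = G k l i j) (i j : Fin 2) :
    ∑ k, ∑ l, ξ k * (ξ l * gSym ξ G i j k l) = 0 := by
  rcases hq with hq | rfl
  swap
  · simp
  obtain rfl | rfl : i = 0 ∨ i = 1 := by omega
  all_goals obtain rfl | rfl : j = 0 ∨ j = 1 := by omega
  all_goals
    simp only [Fin.sum_univ_two, gSym, vSym, uSym, curlSym, hStarSym, rotSym, parSym, rot, kron,
      Matrix.cons_val_zero, Matrix.cons_val_one, h1 1 0, h2 _ _ 1 0, h3 0 1 0 0, h3 1 1 0 0,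
      h3 1 1 0 1, if_true, zero_ne_one, one_ne_zero, if_false, Complex.ofReal_zero,
      Complex.ofReal_one]
    field_simp
    simp only [lapSym]
    ring

end SymbolAlgebra

/-! ### Existence of the decomposition -/

section Existence

open scoped Real

/-- The Fourier symbol of the gradient on the plane. -/
noncomputable def grad (y : Pt 2) : Fin 2 → ℂ := fun i => xi i y

lemma lapSym_grad (y : Pt 2) : lapSym (grad y) = -(4 * π ^ 2 : ℝ) * (‖y‖ ^ 2 : ℝ) := by
  rw [EuclideanSpace.real_norm_sq_eq, Fin.sum_univ_two]
  simp only [lapSym, grad, xi]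
  push_cast
  linear_combination (4 * (π : ℂ) ^ 2 * ((y 0 : ℂ) ^ 2 + (y 1 : ℂ) ^ 2)) * Complex.I_sq

lemma lapSym_grad_ne_zero (y : Pt 2) : lapSym (grad y) ≠ 0 ∨ grad y = 0 := by
  rcases eq_or_ne y 0 with rfl | hy
  · right
    ext i
    simp [grad, xi]
  · left
    rw [lapSym_grad]
    simp [hy, Real.pi_ne_zero]

/-- Makes `parSym` and `rotSym` bounded multipliers; at `y = 0` the quotient is `0` by convention.
-/
lemma norm_div_lapSym_le {a b : ℂ} {y : Pt 2} (ha : ‖a‖ ≤ 2 * π * ‖y‖) (hb : ‖b‖ ≤ 2 * π * ‖y‖) :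
    ‖a * b / lapSym (grad y)‖ ≤ 1 := by
  rw [norm_div, norm_mul, lapSym_grad]
  refine div_le_one_of_le₀ ?_ (norm_nonneg _)
  rw [norm_mul, norm_neg, Complex.norm_real, Complex.norm_real,
    Real.norm_of_nonneg (by positivity), Real.norm_of_nonneg (by positivity)]
  calc ‖a‖ * ‖b‖ ≤ (2 * π * ‖y‖) * (2 * π * ‖y‖) := by gcongr
    _ = 4 * π ^ 2 * ‖y‖ ^ 2 := by ring

lemma norm_rot_grad_le (i : Fin 2) (y : Pt 2) : ‖rot (grad y) i‖ ≤ 2 * π * ‖y‖ := by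
  match i with
  | 0 => simpa [rot, grad] using norm_xi_le 1 y
  | 1 => simpa [rot, grad] using norm_xi_le 0 y

lemma measurable_rot_grad (i : Fin 2) : Measurable fun y => rot (grad y) i := by
  match i with
  | 0 => exact (measurable_xi 1).neg
  | 1 => exact measurable_xi 0

lemma measurable_lapSym_grad : Measurable fun y => lapSym (grad y) :=
  ((measurable_xi 0).pow_const 2).add ((measurable_xi 1).pow_const 2)

lemma RapidlyIntegrable.parSym_mul {V : Pt 2 → ℂ} (hV : RapidlyIntegrable V) (i j : Fin 2) :
    RapidlyIntegrable (fun y => parSym (grad y) i j * V y) :=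
  hV.mul_left_of_bounded (((measurable_xi i).mul (measurable_xi j)).div measurable_lapSym_grad)
    fun y => norm_div_lapSym_le (norm_xi_le i y) (norm_xi_le j y)

lemma RapidlyIntegrable.rotSym_mul {V : Pt 2 → ℂ} (hV : RapidlyIntegrable V) (i j : Fin 2) :
    RapidlyIntegrable (fun y => rotSym (grad y) i j * V y) :=
  hV.mul_left_of_bounded (((measurable_xi i).mul (measurable_rot_grad j)).div
    measurable_lapSym_grad) fun y => norm_div_lapSym_le (norm_xi_le i y) (norm_rot_grad_le j y)

variable {G : Fin 2 → Fin 2 → Fin 2 → Fin 2 → Pt 2 → ℂ}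

lemma rapidlyIntegrable_hStarSym (hG : ∀ i j k l, RapidlyIntegrable (G i j k l)) (i j : Fin 2) :
    RapidlyIntegrable (fun y => hStarSym (grad y) (fun i j k l => G i j k l y) i j) :=
  .sum fun k => .sum fun l => (hG i j k l).parSym_mul k l

lemma rapidlyIntegrable_curlSym (hG : ∀ i j k l, RapidlyIntegrable (G i j k l)) :
    RapidlyIntegrable (fun y => curlSym (grad y) (fun i j k l => G i j k l y)) :=
  .const_mul (.add (.sum fun i => .sum fun j => .sum fun k => (hG i j k k).rotSym_mul j i)
    (.const_mul (.sum fun i => .sum fun j => (rapidlyIntegrable_hStarSym hG i j).rotSym_mul i j)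
      (-1))) 4

lemma rapidlyIntegrable_uSym (hG : ∀ i j k l, RapidlyIntegrable (G i j k l)) (i : Fin 2) :
    RapidlyIntegrable (fun y => uSym (grad y) (fun i j k l => G i j k l y) i) :=
  (rapidlyIntegrable_curlSym hG).mul_left (measurable_rot_grad i) (C := 2 * π) fun y =>
    (norm_rot_grad_le i y).trans (by gcongr; linarith)

lemma rapidlyIntegrable_vSym (hG : ∀ i j k l, RapidlyIntegrable (G i j k l)) (i j : Fin 2) :
    RapidlyIntegrable (fun y => vSym (grad y) (fun i j k l => G i j k l y) i j) :=
  .add (.add ((rapidlyIntegrable_hStarSym hG i j).const_mul 2)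
    (.const_mul (.parSym_mul (.sum fun k => .sum fun l =>
      (rapidlyIntegrable_hStarSym hG k l).parSym_mul k l) i j) (-1)))
    (.const_mul (.add ((rapidlyIntegrable_curlSym hG).rotSym_mul i j)
      ((rapidlyIntegrable_curlSym hG).rotSym_mul j i)) (-1 / 2))

/-- A Schwartz elastic `2`-tensor field of mean zero on the plane has a decomposition whose
components vanish at infinity and whose vector field is divergence free. -/
theorem exists_isDecomposition (f : Fin 2 → Fin 2 → Fin 2 → Fin 2 → 𝓢(Pt 2, ℝ))
    (hf : IsElastic2 (fun i j k l => (f i j k l : Pt 2 → ℝ)))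
    (hmean : ∀ i j k l, ∫ x, f i j k l x = 0) :
    ∃ (v : TensorField2 2) (u : VectorField 2) (g : TensorField4 2),
      IsDecomposition (fun i j k l => (f i j k l : Pt 2 → ℝ)) v u g ∧
      (∀ i j, VanishesAtInfinity (v i j)) ∧ (∀ i, VanishesAtInfinity (u i)) ∧
      (∀ i j k l, VanishesAtInfinity (g i j k l)) ∧ (∀ x, divergence u x = 0) := by
  have hf1 : ∀ i j k l, f i j k l = f j i k l := fun i j k l => DFunLike.coe_injective (hf i j k l).1
  have hf2 : ∀ i j k l, f i j k l = f i j l k := fun i j k l =>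
    DFunLike.coe_injective (hf i j k l).2.1
  have hf3 : ∀ i j k l, f i j k l = f k l i j := fun i j k l =>
    DFunLike.coe_injective (hf i j k l).2.2
  let G : Fin 2 → Fin 2 → Fin 2 → Fin 2 → Pt 2 → ℂ := fun i j k l y =>
    symbolOf (f i j k l) y / lapSym (grad y)
  have hG : ∀ i j k l, RapidlyIntegrable (G i j k l) := by
    intro i j k l
    have h := (rapidlyIntegrable_div_norm_sq _ (symbolOf_zero (hmean i j k l))).const_mul
      (-(4 * π ^ 2 : ℝ) : ℂ)⁻¹
    convert h using 2 with y
    simp only [G, lapSym_grad]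
    rw [div_mul_eq_div_div, div_eq_inv_mul _ (-_ : ℂ), mul_div_assoc]
  -- At the origin both sides vanish only because `f` has mean zero.
  have hFG : ∀ i j k l y, symbolOf (f i j k l) y = lapSym (grad y) * G i j k l y := by
    intro i j k l y
    rcases eq_or_ne y 0 with rfl | hy
    · simp [G, symbolOf_zero (hmean i j k l)]
    · have : lapSym (grad y) ≠ 0 := by
        rw [lapSym_grad]
        simp [hy, Real.pi_ne_zero]
      simp only [G]
      field_simp
  have hG1 : ∀ y i j k l, G i j k l y = G j i k l y := fun y i j k l => by
    simp only [G, hf1 i j k l]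
  have hG2 : ∀ y i j k l, G i j k l y = G i j l k y := fun y i j k l => by
    simp only [G, hf2 i j k l]
  have hG3 : ∀ y i j k l, G i j k l y = G k l i j y := fun y i j k l => by
    simp only [G, hf3 i j k l]
  let v : TensorField2 2 := fun i j x =>
    (FourierTransform.fourier (fun y => vSym (grad y) (fun i j k l => G i j k l y) i j) x).re
  let u : VectorField 2 := fun i x =>
    (FourierTransform.fourier (fun y => uSym (grad y) (fun i j k l => G i j k l y) i) x).re
  have hv : ∀ i j, HasSymbol (v i j) (fun y => vSym (grad y) (fun i j k l => G i j k l y) i j) :=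
    fun i j => (rapidlyIntegrable_vSym hG i j).hasSymbol
  have hu : ∀ i, HasSymbol (u i) (fun y => uSym (grad y) (fun i j k l => G i j k l y) i) :=
    fun i => (rapidlyIntegrable_uSym hG i).hasSymbol
  -- With `g` the remainder, the sum formula is immediate. The content lies in its symbol `gSym`,
  -- which gives smoothness, decay and both adjoint equations.
  let g : TensorField4 2 := fun i j k l x => f i j k l x - (opH v i j k l x + opK u i j k l x)
  have hv_symm : IsElastic1 v := by
    intro i j
    ext x
    simp only [v]
    simp only [fun y => vSym_symm (ξ := grad y) (hG1 y) i j]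
  have hg : ∀ i j k l, HasSymbol (g i j k l)
      (fun y => gSym (grad y) (fun i j k l => G i j k l y) i j k l) := by
    intro i j k l
    have hH := ((((hv k l).pd j).pd i).add (((hv i j).pd l).pd k)).const_mul (1 / 2)
    have hK1 := (((hu j).pd i).add ((hu i).pd j)).const_mul (1 / 4 * kron k l)
    have hK2 := (((hu l).pd k).add ((hu k).pd l)).const_mul (1 / 4 * kron i j)
    have h := (hasSymbol_symbolOf (f i j k l)).add ((hH.add (hK1.add hK2)).const_mul (-1))
    convert h using 1
    · ext x
      simp only [g, opH, opK]
      ring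
    · ext y
      simp only [hFG, gSym, grad]
      push_cast
      ring
  refine ⟨v, u, g, ⟨fun i j => (hv i j).contDiff, fun i => (hu i).contDiff,
    fun i j k l => (hg i j k l).contDiff, hv_symm, ?_, ?_, ?_, ?_⟩,
    fun i j => (hv i j).vanishesAtInfinity, fun i => (hu i).vanishesAtInfinity,
    fun i j k l => (hg i j k l).vanishesAtInfinity, ?_⟩
  · intro i j k l
    have hkron : ∀ a b : Fin 2, kron a b = kron b a := fun a b => by simp only [kron, eq_comm]
    refine ⟨?_, ?_, ?_⟩ <;> ext x <;> simp only [g, opH, opK]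
    · rw [hf1 i j k l, pd_comm i j (hv k l).contDiff, hv_symm i j, hkron i j]
      ring
    · rw [hf2 i j k l, pd_comm k l (hv i j).contDiff, hv_symm k l, hkron k l]
      ring
    · rw [hf3 i j k l]
      ring
  · intro i j k l x
    simp only [g]
    ring
  · intro i x
    rw [opKStar, neg_eq_zero]
    exact (HasSymbol.sum fun k => HasSymbol.sum fun j => (hg i j k k).pd j).eq_zero (fun y =>
      sum_mul_gSym (lapSym_grad_ne_zero y) (hG1 y) (hG2 y) (hG3 y) i) x
  · intro i j x
    exact (HasSymbol.sum fun k => HasSymbol.sum fun l => ((hg i j k l).pd l).pd k).eq_zero (fun y =>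
      sum_mul_mul_gSym (lapSym_grad_ne_zero y) (hG1 y) (hG2 y) (hG3 y) i j) x
  · intro x
    exact (HasSymbol.sum fun i => (hu i).pd i).eq_zero (fun y => sum_mul_uSym (ξ := grad y)) x

end Existence

end Elastic

theorem mainTheorem4
    (f : Fin 2 → Fin 2 → Fin 2 → Fin 2 → 𝓢(Elastic.Pt 2, ℝ))
    (hf : Elastic.IsElastic2 (fun i j k l => (f i j k l : Elastic.Pt 2 → ℝ)))
    (hmean : ∀ i j k l, ∫ x, f i j k l x = 0) :
    ∃ (v : Elastic.TensorField2 2) (u : Elastic.VectorField 2) (g : Elastic.TensorField4 2),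
      Elastic.IsDecomposition (fun i j k l => (f i j k l : Elastic.Pt 2 → ℝ)) v u g ∧
      (∀ i j, Elastic.VanishesAtInfinity (v i j)) ∧
      (∀ i, Elastic.VanishesAtInfinity (u i)) ∧
      (∀ i j k l, Elastic.VanishesAtInfinity (g i j k l)) ∧
      (∀ x, Elastic.divergence u x = 0) ∧
      ∀ (v' : Elastic.TensorField2 2) (u' : Elastic.VectorField 2) (g' : Elastic.TensorField4 2),
        Elastic.IsDecomposition (fun i j k l => (f i j k l : Elastic.Pt 2 → ℝ)) v' u' g' →
        (∀ i j, Elastic.VanishesAtInfinity (v' i j)) →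
        (∀ i, Elastic.VanishesAtInfinity (u' i)) →
        g' = g ∧ ((∀ x, Elastic.divergence u' x = 0) → v' = v ∧ u' = u) := by
  obtain ⟨v, u, g, hdec, hv, hu, hg, hdiv⟩ := Elastic.exists_isDecomposition f hf hmean
  refine ⟨v, u, g, hdec, hv, hu, hg, hdiv, fun v' u' g' hdec' hv' hu' => ?_⟩
  obtain ⟨h1, h2⟩ := (hdec'.sub hdec).eq_zero
    (fun i j => by simpa [Elastic.VanishesAtInfinity] using! (hv' i j).sub (hv i j))
    (fun i => by simpa [Elastic.VanishesAtInfinity] using! (hu' i).sub (hu i))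
  refine ⟨sub_eq_zero.1 h1, fun hdiv' => ?_⟩
  obtain ⟨h3, h4⟩ := h2 fun x => by
    have e := hdiv x
    have e' := hdiv' x
    simp only [Elastic.divergence, Fin.sum_univ_two, Pi.sub_apply] at e e' ⊢
    rw [Elastic.pd_sub 0 (hdec'.smooth_u 0) (hdec.smooth_u 0),
      Elastic.pd_sub 1 (hdec'.smooth_u 1) (hdec.smooth_u 1)]
    simp only [Pi.sub_apply]
    linarith
  exact ⟨sub_eq_zero.1 h3, sub_eq_zero.1 h4⟩
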